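/- Let $\lambda$ and $\mu$ be strict partitions (partitions with distinct positive parts, indexed decreasingly and padded with zeros) with $\mu_i\le\lambda_i$ for all $i$, and let $S(\lambda)$ be the shifted diagram of $\lambda$, whose squares are the $(i,j)$ with $i\le j\le i+\lambda_i-1$. Put $S(\lambda/\mu)=S(\lambda)\setminus S(\mu)$ and $|\lambda/\mu|=|S(\lambda/\mu)|$. A *strip* is a nonempty, rookwise connected $S(\lambda/\mu)$ with at most one square on each diagonal $\{j-i=d\}$; if it occupies $h$ rows, its weight is $(-1)^{h-1}$. A *double strip* is an $S(\lambda/\mu)$ that is the disjoint union of two strips $S(\lambda/\nu)$ and $S(\nu/\mu)$, with $\nu$ a strict partition, each containing a square $(j,j)$; its weight is $2(-1)^{\alpha+\beta-1}$, where $\alpha$ is its number of diagonals of length two and $\beta$ is the number of rows occupied by its diagonals of length one. A *strip tableau* of shape $\lambda/\mu$ and type $\pi=(\pi_1,\dots,\pi_k)$ is a chain of strict partitions $\mu=\lambda^0\subseteq\lambda^1\subseteq\cdots\subseteq\lambda^k=\lambda$ such that each $S(\lambda^i/\lambda^{i-1})$ is a strip or a double strip with $\pi_i$ squares; its weight $wt(T)$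 is the product of their weights. The *skew Schur $Q$-function* is $$Q_{\lambda/\mu}=\sum_{\pi}\sum_{T}2^{\ell(\pi)}\,wt(T)\,\frac{p_\pi}{z_\pi},$$ where $\pi$ runs over the partitions of $|\lambda/\mu|$ with only odd parts, $T$ over the strip tableaux of shape $\lambda/\mu$ and type $\pi$, $p_\pi=\prod_i p_{\pi_i}$ with $p_k=\sum_{i}x_i^k$ in infinitely many variables, and $z_\pi=\prod_i i^{m_i}m_i!$ if $\pi$ has $m_i$ parts equal to $i$. A *skew bar tableau* of shape $\lambda/\mu$ is a filling of $S(\lambda)$ with nonnegative integers such that (1) rows are weakly increasing; (2) every positive integer that occurs does so an odd number of times; (3) every positive integer occurs in at most two rows, and if it occurs in two rows then both begin with it; (4) for every $a\geq 0$, the nonzero row lengths that remain after removing all entries larger than $a$ are distinct; (5) the rows that remain after removing all positive entries are, up to order, those of $\mu$. Its number of bars is the number of distinct positive integers that occur in it, and $\mathrm{srank}(\lambda/\mu)$ is the least number of bars of a skew bar tableau of shape $\lambda/\mu$. Then every term of $Q_{\lambda/\mu}$ has degree at least $\mathrm{srank}(\lambda/\mu)$, where $\deg p_\nu=\ell(\nu)$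 is the number of parts of $\nu$. That is, $Q_{\lambda/\mu}$ has a unique expansion $\sum_\nu c_\nu p_\nu$ as a finite rational linear combination of power sums $p_\nu$ ($\nu$ ranging over all partitions), and $\ell(\nu)\ge\mathrm{srank}(\lambda/\mu)$ whenever $c_\nu\ne 0$. -/

import Mathlib

/-- A strict partition `λ₁ > λ₂ > ⋯ > λ_k > 0`, padded with zeros; `part i` is `λ_{i+1}`. -/
@[ext]
structure StrictPartition where
  part : ℕ → ℕ
  strict : ∀ i, part (i + 1) < part i ∨ part (i + 1) = 0

namespace StrictPartition

/-- Containment of diagrams: `μ_i ≤ λ_i` for all `i`. -/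
instance : LE StrictPartition := ⟨fun mu lam => ∀ i, mu.part i ≤ lam.part i⟩

theorem part_add_le (lam : StrictPartition) (i : ℕ) (h : lam.part i ≠ 0) :
    lam.part i + i ≤ lam.part 0 := by
  induction i with
  | zero => simp
  | succ k ih =>
    have h1 := lam.strict k
    have h2 := ih (by omega)
    omega

/-- The shifted diagram `S(λ)`: row `i` (counted from `0`) consists of the `λ_{i+1}` squares
`(i, j)` with `i ≤ j < i + λ_{i+1}`. -/
def shifted (lam : StrictPartition) : Finset (ℕ × ℕ) :=
  (Finset.range (lam.part 0) ×ˢ Finset.range (lam.part 0)).filter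
    (fun c => c.1 ≤ c.2 ∧ c.2 < c.1 + lam.part c.1)

theorem mem_shifted (lam : StrictPartition) (c : ℕ × ℕ) :
    c ∈ lam.shifted ↔ c.1 ≤ c.2 ∧ c.2 < c.1 + lam.part c.1 := by
  simp only [shifted, Finset.mem_filter, Finset.mem_product, Finset.mem_range,
    and_iff_right_iff_imp]
  rintro ⟨h1, h2⟩
  have := lam.part_add_le c.1 (by omega)
  omega

theorem finite_le (lam : StrictPartition) : Finite {mu : StrictPartition // mu ≤ lam} := by
  refine Finite.of_injective
    (fun mu (i : Fin (lam.part 0)) =>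
      (⟨mu.1.part i, Nat.lt_succ_of_le (mu.2 i |>.trans (by
        by_cases h : lam.part i = 0
        · omega
        · have := lam.part_add_le i h
          omega))⟩ : Fin (lam.part 0 + 1))) ?_
  intro mu nu h
  ext i
  by_cases hi : i < lam.part 0
  · simpa using congrFun h ⟨i, hi⟩
  · have h0 : lam.part i = 0 := by
      by_contra h'
      have := lam.part_add_le i h'
      omega
    have h1 := mu.2 i
    have h2 := nu.2 i
    omega

end StrictPartition

/-- The skew shifted diagram `S(λ/μ) = S(λ) \ S(μ)`. -/
def skewShifted (lam mu : StrictPartition) : Finset (ℕ × ℕ) := lam.shifted \ mu.shifted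

/-! ### Strips, double strips and strip tableaux -/

/-- Two squares share an edge. -/
def RookAdj (a b : ℕ × ℕ) : Prop :=
  (a.1 = b.1 ∧ (a.2 = b.2 + 1 ∨ b.2 = a.2 + 1)) ∨ (a.2 = b.2 ∧ (a.1 = b.1 + 1 ∨ b.1 = a.1 + 1))

/-- A nonempty set of squares any two of which are joined by a path of edge-adjacent squares. -/
def RookConnected (D : Finset (ℕ × ℕ)) : Prop :=
  D.Nonempty ∧ ∀ a ∈ D, ∀ b ∈ D, Relation.ReflTransGen (fun x y => y ∈ D ∧ RookAdj x y) a b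

/-- The squares of `D` on the diagonal `(0, d), (1, d + 1), (2, d + 2), …`. -/
def diagonal (D : Finset (ℕ × ℕ)) (d : ℕ) : Finset (ℕ × ℕ) := D.filter (fun c => c.2 = c.1 + d)

/-- `S(λ/μ)` is a strip. -/
def IsStrip (lam mu : StrictPartition) : Prop :=
  RookConnected (skewShifted lam mu) ∧ ∀ d, (diagonal (skewShifted lam mu) d).card ≤ 1

/-- `S(λ/μ)` is a double strip: it is the (disjoint) union of two strips `S(λ/ν)` and `S(ν/μ)`,
both of which start on the diagonal of the squares `(j, j)`. -/
def IsDoubleStrip (lam mu : StrictPartition) : Prop :=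
  ∃ nu : StrictPartition, mu ≤ nu ∧ nu ≤ lam ∧ IsStrip lam nu ∧ IsStrip nu mu ∧
    (diagonal (skewShifted lam nu) 0).Nonempty ∧ (diagonal (skewShifted nu mu) 0).Nonempty

/-- The number of rows that a strip occupies. -/
def height (D : Finset (ℕ × ℕ)) : ℕ := (D.image Prod.fst).card

/-- The depth `α + β` of a double strip: `α` is the number of diagonals of length two, and the
diagonals of length one occupy `β` rows. -/
def depth (D : Finset (ℕ × ℕ)) : ℕ :=
  ((D.image (fun c => c.2 - c.1)).filter (fun d => (diagonal D d).card = 2)).card +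
    ((D.filter (fun c => (diagonal D (c.2 - c.1)).card = 1)).image Prod.fst).card

open Classical in
/-- The weight of a strip of height `h` is `(-1)^(h-1)`, that of a double strip of depth `d`
is `2(-1)^(d-1)`. (A shape that is neither never occurs in a strip tableau.) -/
noncomputable def stepWeight (lam mu : StrictPartition) : ℚ :=
  if IsStrip lam mu then (-1) ^ (height (skewShifted lam mu) - 1)
  else if IsDoubleStrip lam mu then 2 * (-1) ^ (depth (skewShifted lam mu) - 1)
  else 0

/-- A strip tableau of shape `λ/μ` and type `π = (π₁, …, π_k)`. -/
@[ext]
structure StripTableau (lam mu : StrictPartition) (pi : List ℕ) where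
  shape : Fin (pi.length + 1) → StrictPartition
  first : shape 0 = mu
  last : shape (Fin.last pi.length) = lam
  mono : ∀ i : Fin pi.length, shape i.castSucc ≤ shape i.succ
  size : ∀ i : Fin pi.length, (skewShifted (shape i.succ) (shape i.castSucc)).card = pi.get i
  step : ∀ i : Fin pi.length, IsStrip (shape i.succ) (shape i.castSucc) ∨
    IsDoubleStrip (shape i.succ) (shape i.castSucc)

/-- There are finitely many strip tableaux of given shape and type. -/
instance (lam mu : StrictPartition) (pi : List ℕ) : Finite (StripTableau lam mu pi) := by
  have key : ∀ (T : StripTableau lam mu pi) (i : Fin (pi.length + 1)), T.shape i ≤ lam := by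
    intro T i
    induction i using Fin.reverseInduction with
    | last => rw [T.last]; exact fun _ => le_rfl
    | cast j ih => exact fun n => (T.mono j n).trans (ih n)
  have := lam.finite_le
  refine Finite.of_injective
    (fun T (i : Fin (pi.length + 1)) => (⟨T.shape i, key T i⟩ : {mu // mu ≤ lam})) ?_
  intro T U h
  ext i : 2
  exact congrArg Subtype.val (congrFun h i)

/-- The weight of a strip tableau: the product of the weights of its strips and double strips. -/
noncomputable def StripTableau.weight {lam mu : StrictPartition} {pi : List ℕ}
    (T : StripTableau lam mu pi) : ℚ :=
  ∏ i : Fin pi.length, stepWeight (T.shape i.succ) (T.shape i.castSucc)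

/-! ### Power sums and the skew Schur `Q`-function -/

open Classical in
/-- The power sum `p_k = ∑_i x_i^k` (for `k ≥ 1`), as a formal power series in the variables
`x_0, x_1, x_2, …`: its coefficient is `1` at the monomials `x_i^k` and `0` elsewhere. -/
noncomputable def powerSum (k : ℕ) : MvPowerSeries ℕ ℚ :=
  fun m => if ∃ i : ℕ, m = Finsupp.single i k then 1 else 0

/-- `p_π = p_{π₁} p_{π₂} ⋯`. -/
noncomputable def powerSumPartition {n : ℕ} (pi : n.Partition) : MvPowerSeries ℕ ℚ :=
  (pi.parts.map powerSum).prod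

/-- `z_π = 1^{m₁} m₁! 2^{m₂} m₂! ⋯`, where `m_i` is the number of parts of `π` equal to `i`. -/
def zee {n : ℕ} (pi : n.Partition) : ℕ :=
  ∏ i ∈ pi.parts.toFinset, i ^ pi.parts.count i * (pi.parts.count i).factorial

/-- The skew Schur `Q`-function
`Q_{λ/μ} = ∑_π ∑_T 2^{ℓ(π)} wt(T) p_π / z_π`, where `π` runs over the partitions of `|λ/μ|` with
only odd parts and `T` over the strip tableaux of shape `λ/μ` and type `π` (the parts of `π` being
listed in weakly decreasing order). -/
noncomputable def skewQ (lam mu : StrictPartition) : MvPowerSeries ℕ ℚ :=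
  ∑ pi ∈ Nat.Partition.odds (skewShifted lam mu).card,
    ∑ᶠ T : StripTableau lam mu (pi.parts.sort (· ≥ ·)),
      ((2 : ℚ) ^ pi.parts.card * T.weight / (zee pi : ℚ)) • powerSumPartition pi

/-- `f = ∑_π c_π p_π`, a finite sum over partitions `π` of arbitrary natural numbers. -/
def IsPowerSumExpansion (f : MvPowerSeries ℕ ℚ) (c : (Σ n : ℕ, n.Partition) →₀ ℚ) : Prop :=
  f = c.sum (fun pi a => a • powerSumPartition pi.2)

/-! ### Skew bar tableaux and the srank -/

/-- The number of squares in row `i` of `S(λ)` whose entry is at most `a`. -/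
def rowLength (lam : StrictPartition) (entry : ℕ × ℕ → ℕ) (a i : ℕ) : ℕ :=
  (lam.shifted.filter (fun c => c.1 = i ∧ entry c ≤ a)).card

/-- A skew bar tableau of shape `λ/μ`: a filling of the squares of `S(λ)` with nonnegative
integers (`entry` is set to `0` off `S(λ)`) such that
(1) every row is weakly increasing;
(2) every positive integer that appears does so an odd number of times;
(3) a positive integer appears in at most two rows, and if it appears in two rows, then both rows
begin with it;
(4) for every `a`, the nonzero row lengths left after the squares with entries larger than `a`
have been removed are distinct;
(5) when all squares with positive entries are removed, the remaining rows are, after reordering,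
those of `μ`. -/
structure SkewBarTableau (lam mu : StrictPartition) where
  entry : ℕ × ℕ → ℕ
  entry_off : ∀ c, c ∉ lam.shifted → entry c = 0
  row_weak : ∀ i j k, (i, j) ∈ lam.shifted → (i, k) ∈ lam.shifted → j ≤ k →
    entry (i, j) ≤ entry (i, k)
  odd_count : ∀ a, 0 < a → (∃ c ∈ lam.shifted, entry c = a) →
    Odd (lam.shifted.filter (fun c => entry c = a)).card
  two_rows : ∀ a, 0 < a →
    ((lam.shifted.filter (fun c => entry c = a)).image Prod.fst).card ≤ 2
  begins : ∀ a, 0 < a → ∀ c ∈ lam.shifted, ∀ d ∈ lam.shifted, entry c = a → entry d = a →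
    c.1 ≠ d.1 → entry (c.1, c.1) = a ∧ entry (d.1, d.1) = a
  distinct : ∀ a i j, i ≠ j → rowLength lam entry a i = rowLength lam entry a j →
    rowLength lam entry a i = 0
  inner : ∃ s : Equiv.Perm ℕ, ∀ i, rowLength lam entry 0 (s i) = mu.part i

theorem StrictPartition.part_lt (lam : StrictPartition) {i j : ℕ} (h : i < j)
    (hj : lam.part j ≠ 0) : lam.part j < lam.part i := by
  induction j, h using Nat.le_induction with
  | base =>
    have := lam.strict i
    simp only [Nat.succ_eq_add_one] at hj ⊢
    omega
  | succ k hk ih =>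
    have h1 := lam.strict k
    have h2 := ih (by omega)
    omega

theorem rowLength_eq (lam : StrictPartition) (entry : ℕ × ℕ → ℕ) (a i m : ℕ)
    (hm : m ≤ lam.part i)
    (h : ∀ t, t < lam.part i → (entry (i, i + t) ≤ a ↔ t < m)) :
    rowLength lam entry a i = m := by
  have : lam.shifted.filter (fun c => c.1 = i ∧ entry c ≤ a)
      = (Finset.range m).image (fun t => (i, i + t)) := by
    ext ⟨x, y⟩
    simp only [Finset.mem_filter, StrictPartition.mem_shifted, Finset.mem_image, Finset.mem_range,
      Prod.mk.injEq]
    constructor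
    · rintro ⟨⟨h1, h2⟩, rfl, h3⟩
      obtain ⟨t, rfl⟩ := Nat.exists_eq_add_of_le h1
      exact ⟨t, (h t (by omega)).1 h3, rfl, rfl⟩
    · rintro ⟨t, ht, rfl, rfl⟩
      exact ⟨⟨by omega, by omega⟩, rfl, (h t (by omega)).2 ht⟩
  rw [rowLength, this, Finset.card_image_of_injective, Finset.card_range]
  intro s t hst
  simpa using hst

/-- Skew bar tableaux of shape `λ/μ` exist (one may take every bar to be a single square), so that
`srank` below is a minimum over a nonempty set. -/
theorem nonempty_skewBarTableau (lam mu : StrictPartition) (hmu : mu ≤ lam) :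
    Nonempty (SkewBarTableau lam mu) := by
  classical
  let e : ℕ × ℕ → ℕ := fun c =>
    if c ∈ lam.shifted \ mu.shifted then c.1 * lam.part 0 + c.2 + 1 else 0
  have bd : ∀ c ∈ lam.shifted, c.2 < lam.part 0 := by
    intro c hc
    rw [StrictPartition.mem_shifted] at hc
    have := lam.part_add_le c.1 (by omega)
    omega
  have inj : ∀ c ∈ lam.shifted, ∀ d ∈ lam.shifted, 0 < e c → e c = e d → c = d := by
    intro c hc d hd h0 h
    have hc' := bd c hc
    have hd' := bd d hd
    simp only [e] at h0 h
    split_ifs at h0 h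
    · have h1 : c.1 = d.1 := by
        rcases lt_trichotomy c.1 d.1 with h1 | h1 | h1
        · nlinarith [Nat.mul_le_mul_right (lam.part 0) h1]
        · exact h1
        · nlinarith [Nat.mul_le_mul_right (lam.part 0) h1]
      rw [h1] at h
      exact Prod.ext h1 (by omega)
    all_goals omega
  have one : ∀ a, 0 < a → (lam.shifted.filter (fun c => e c = a)).card ≤ 1 := by
    intro a ha
    rw [Finset.card_le_one]
    intro c hc d hd
    rw [Finset.mem_filter] at hc hd
    exact inj c hc.1 d hd.1 (by omega) (by omega)
  have val : ∀ i t, t < lam.part i →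
      e (i, i + t) = if t < mu.part i then 0 else i * lam.part 0 + (i + t) + 1 := by
    intro i t ht
    simp only [e, Finset.mem_sdiff, StrictPartition.mem_shifted]
    split_ifs <;> first | rfl | omega
  have rl : ∀ a i, rowLength lam e a i
      = min (lam.part i) (max (mu.part i) (a - i * lam.part 0 - i)) := by
    intro a i
    refine rowLength_eq lam e a i _ (min_le_left _ _) ?_
    intro t ht
    rw [val i t ht]
    split_ifs <;> omega
  have key : ∀ a i j, i < j → rowLength lam e a i = rowLength lam e a j →
      rowLength lam e a i = 0 := by
    intro a i j hij h
    rw [rl, rl] at h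
    rw [rl]
    by_contra hne
    have hj : lam.part j ≠ 0 := by omega
    have h1 := lam.part_lt hij hj
    have h2 := lam.part_add_le i (by omega)
    have h3 : i * lam.part 0 + lam.part 0 ≤ j * lam.part 0 := by
      have := Nat.mul_le_mul_right (lam.part 0) hij
      rwa [Nat.succ_mul] at this
    have h4 := hmu i
    by_cases hm : mu.part j = 0
    · omega
    · have h5 := mu.part_lt hij hm
      omega
  refine ⟨⟨e, ?_, ?_, ?_, ?_, ?_, ?_, ?_⟩⟩
  · intro c hc
    simp [e, hc]
  · intro i j k hj hk hjk
    simp only [StrictPartition.mem_shifted] at hj hk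
    simp only [e, Finset.mem_sdiff, StrictPartition.mem_shifted]
    split_ifs <;> omega
  · rintro a ha ⟨c, hc, hca⟩
    have h1 := one a ha
    have h2 : 0 < (lam.shifted.filter (fun c => e c = a)).card :=
      Finset.card_pos.2 ⟨c, Finset.mem_filter.2 ⟨hc, hca⟩⟩
    rw [show (lam.shifted.filter (fun c => e c = a)).card = 1 by omega]
    exact odd_one
  · intro a ha
    exact (Finset.card_image_le.trans (one a ha)).trans (by norm_num)
  · intro a ha c hc d hd h1 h2 h3
    exact absurd (congrArg Prod.fst (inj c hc d hd (by omega) (by omega))) h3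
  · intro a i j hij h
    rcases lt_or_gt_of_ne hij with h' | h'
    · exact key a i j h' h
    · rw [h]; exact key a j i h' h.symm
  · refine ⟨1, fun i => ?_⟩
    have := hmu i
    rw [Equiv.Perm.one_apply, rl]
    omega

/-- The number of bars: the number of distinct positive entries. -/
def SkewBarTableau.numBars {lam mu : StrictPartition} (T : SkewBarTableau lam mu) : ℕ :=
  ((lam.shifted.image T.entry).filter (fun a => 0 < a)).card

/-- `srank(λ/μ)`: the number of bars in a skew bar tableau of shape `λ/μ` that has as few bars as
possible. -/
noncomputable def srank (lam mu : StrictPartition) : ℕ :=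
  sInf (Set.range (fun T : SkewBarTableau lam mu => T.numBars))

/-! ### Linear independence of products of power sums -/

/-! The definition of `skewQ` is already an expansion in power sums p_π, and the p_π are linearly
independent (`linearIndependent_powerSumPartition`), so it is the only one. A nonzero coefficient at
p_π therefore forces a strip tableau of type π to exist, and it remains to turn that into a skew bar
tableau with at most ℓ(π) bars.

The link is the effect of one step on the set of parts. Diagonal d of S(λ) has as many squares as λ
has parts larger than d, and a strip covers an interval [p, q) of diagonals once each. Comparing
neighbouring diagonals shows that removing the strip replaces the part q by p (`IsStrip.hasPart`).
In a double strip both intervals start at 0, so two parts disappear (`IsDoubleStrip.hasPart`). These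
are the two kinds of bar: the end of one row, or two whole rows. Its size is odd because π has odd
parts. If the rows are never re-sorted, the row lengths form a monotone chain, and labelling each
square by the step that adds it gives the tableau (`exists_skewBarTableau_of_chain`). -/

theorem coeff_prod_powerSum_nonneg (s : Multiset ℕ) (m : ℕ →₀ ℕ) :
    0 ≤ MvPowerSeries.coeff m (s.map powerSum).prod := by
  classical
  induction s using Multiset.induction_on generalizing m with
  | empty =>
    rw [Multiset.map_zero, Multiset.prod_zero, MvPowerSeries.coeff_one]
    split_ifs <;> simp
  | cons k s ih =>
    rw [Multiset.map_cons, Multiset.prod_cons, MvPowerSeries.coeff_mul]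
    refine Finset.sum_nonneg fun x _ => mul_nonneg ?_ (ih _)
    change 0 ≤ powerSum k x.1
    rw [powerSum]
    split_ifs <;> simp

/-- The exponent vector of the monomial `∏ x_i ^ k`, the product running over the pairs
`(i, k)` in `t`. -/
noncomputable def exponentOf (t : Multiset (ℕ × ℕ)) : ℕ →₀ ℕ :=
  (t.map (fun x => Finsupp.single x.1 x.2)).sum

/-- Expanding the product chooses one variable x_i in every factor p_k; `t` records the chosen pairs
(i, k). -/
theorem exists_exponentOf_of_coeff_ne_zero (s : Multiset ℕ) (m : ℕ →₀ ℕ)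
    (h : MvPowerSeries.coeff m (s.map powerSum).prod ≠ 0) :
    ∃ t : Multiset (ℕ × ℕ), t.map Prod.snd = s ∧ exponentOf t = m := by
  classical
  induction s using Multiset.induction_on generalizing m with
  | empty =>
    rw [Multiset.map_zero, Multiset.prod_zero, MvPowerSeries.coeff_one] at h
    refine ⟨0, rfl, ?_⟩
    by_contra hm
    exact h (if_neg fun h0 => hm (by simp [exponentOf, h0]))
  | cons k s ih =>
    rw [Multiset.map_cons, Multiset.prod_cons, MvPowerSeries.coeff_mul] at h
    obtain ⟨x, hx, hne⟩ := Finset.exists_ne_zero_of_sum_ne_zero h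
    obtain ⟨t, ht, hsum⟩ := ih x.2 (right_ne_zero_of_mul hne)
    have h1 : powerSum k x.1 ≠ 0 := left_ne_zero_of_mul hne
    rw [powerSum] at h1
    obtain ⟨i, hi⟩ : ∃ i, x.1 = Finsupp.single i k := by
      by_contra hcon
      exact h1 (if_neg hcon)
    refine ⟨(i, k) ::ₘ t, by simp [ht], ?_⟩
    rw [← Finset.HasAntidiagonal.mem_antidiagonal.1 hx, hi, ← hsum]
    simp [exponentOf]

/-- The choice `t` itself contributes a positive term, and nothing cancels it because all
coefficients are nonnegative. -/
theorem coeff_exponentOf_pos (t : Multiset (ℕ × ℕ)) :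
    0 < MvPowerSeries.coeff (exponentOf t) ((t.map Prod.snd).map powerSum).prod := by
  classical
  induction t using Multiset.induction_on with
  | empty => simp [exponentOf]
  | cons x t ih =>
    rw [Multiset.map_cons, Multiset.map_cons, Multiset.prod_cons, MvPowerSeries.coeff_mul]
    have h1 : ∀ (k : ℕ) (m : ℕ →₀ ℕ), 0 ≤ MvPowerSeries.coeff m (powerSum k) := by
      intro k m
      simpa using coeff_prod_powerSum_nonneg {k} m
    refine Finset.sum_pos' (fun y _ => mul_nonneg (h1 _ _) (coeff_prod_powerSum_nonneg _ _))
      ⟨(Finsupp.single x.1 x.2, exponentOf t), ?_, mul_pos ?_ ih⟩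
    · simp [exponentOf]
    · change 0 < powerSum x.2 (Finsupp.single x.1 x.2)
      rw [powerSum, if_pos ⟨x.1, rfl⟩]
      exact one_pos

theorem support_exponentOf_subset (t : Multiset (ℕ × ℕ)) :
    (exponentOf t).support ⊆ (t.map Prod.fst).toFinset := by
  classical
  induction t using Multiset.induction_on with
  | empty => simp [exponentOf]
  | cons x t ih =>
    have h : exponentOf (x ::ₘ t) = Finsupp.single x.1 x.2 + exponentOf t := by simp [exponentOf]
    rw [h, Multiset.map_cons, Multiset.toFinset_cons]
    refine Finsupp.support_add.trans (Finset.union_subset ?_ ?_)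
    · exact Finsupp.support_single_subset.trans (by simp)
    · exact ih.trans (Finset.subset_insert _ _)

/-- With distinct variables no two exponents are added together, so the pairs can be read back from
the monomial. -/
theorem support_exponentOf_of_nodup (t : Multiset (ℕ × ℕ)) (hnd : (t.map Prod.fst).Nodup)
    (hpos : ∀ x ∈ t, x.2 ≠ 0) :
    (exponentOf t).support.val = t.map Prod.fst ∧
      (t.map Prod.fst).map (exponentOf t) = t.map Prod.snd := by
  classical
  induction t using Multiset.induction_on with
  | empty => simp [exponentOf]
  | cons x t ih =>
    have h : exponentOf (x ::ₘ t) = Finsupp.single x.1 x.2 + exponentOf t := by simp [exponentOf]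
    rw [Multiset.map_cons, Multiset.nodup_cons] at hnd
    obtain ⟨h1, h2⟩ := ih hnd.2 fun y hy => hpos y (Multiset.mem_cons_of_mem hy)
    have hx : x.1 ∉ (exponentOf t).support := by
      rw [← Finset.mem_val, h1]
      exact hnd.1
    have hx2 := hpos x (Multiset.mem_cons_self _ _)
    rw [h]
    constructor
    · rw [Finsupp.support_single_add hx hx2, Finset.cons_val, h1, Multiset.map_cons]
    · rw [Multiset.map_cons, Multiset.map_cons, Multiset.map_cons, ← h2]
      congr 1
      · simp [Finsupp.notMem_support_iff.1 hx]
      · refine Multiset.map_congr rfl fun i hi => ?_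
        have : x.1 ≠ i := fun e => hnd.1 (e ▸ hi)
        simp [Finsupp.single_eq_of_ne this.symm]

theorem exists_exponentOf_nodup (s : Multiset ℕ) :
    ∃ t : Multiset (ℕ × ℕ), t.map Prod.snd = s ∧ (t.map Prod.fst).Nodup ∧
      ∀ x ∈ t, x.1 < s.card := by
  induction s using Multiset.induction_on with
  | empty => exact ⟨0, by simp⟩
  | cons k s ih =>
    obtain ⟨t, h1, h2, h3⟩ := ih
    -- The bound on the indices in `t` makes the variable with index `s.card` new.
    refine ⟨(s.card, k) ::ₘ t, by simp [h1], ?_, ?_⟩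
    · rw [Multiset.map_cons, Multiset.nodup_cons]
      refine ⟨fun hmem => ?_, h2⟩
      obtain ⟨x, hx, he⟩ := Multiset.mem_map.1 hmem
      exact absurd (h3 x hx) (by omega)
    · intro x hx
      rw [Multiset.card_cons]
      rcases Multiset.mem_cons.1 hx with rfl | hx
      · simp
      · exact (h3 x hx).trans (Nat.lt_succ_self _)

/-- The monomial involves `t.card` variables while `u` has at most that many pairs, so the variables
of `u` are distinct too. Both multisets are then the exponents of the same monomial. -/
theorem map_snd_eq_of_exponentOf_eq {t u : Multiset (ℕ × ℕ)} (ht : (t.map Prod.fst).Nodup)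
    (htpos : ∀ x ∈ t, x.2 ≠ 0) (hupos : ∀ x ∈ u, x.2 ≠ 0) (hcard : u.card ≤ t.card)
    (h : exponentOf u = exponentOf t) : u.map Prod.snd = t.map Prod.snd := by
  classical
  obtain ⟨h1, h2⟩ := support_exponentOf_of_nodup t ht htpos
  have h3 : t.card = (exponentOf u).support.card := by
    rw [h, Finset.card_def, h1, Multiset.card_map]
  have h4 := Finset.card_le_card (support_exponentOf_subset u)
  have h5 : (u.map Prod.fst).Nodup := by
    rw [← Multiset.toFinset_card_eq_card_iff_nodup]
    have h6 := Multiset.toFinset_card_le (u.map Prod.fst)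
    rw [Multiset.card_map] at h6 ⊢
    omega
  obtain ⟨h6, h7⟩ := support_exponentOf_of_nodup u h5 hupos
  rw [← h2, ← h7, ← h1, ← h6, h]

theorem linearIndependent_powerSumPartition :
    LinearIndependent ℚ (fun pi : Σ n : ℕ, n.Partition => powerSumPartition pi.2) := by
  classical
  rw [linearIndependent_iff]
  intro c hc
  by_contra hne
  -- For a partition of maximal length in the support, the monomial with its parts as exponents of
  -- distinct variables occurs in no other p_ρ of the relation, since ρ has at most as many parts.
  obtain ⟨pi, hpi, hmax⟩ := c.support.exists_max_image (fun x => x.2.parts.card)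
    (Finsupp.support_nonempty_iff.2 hne)
  obtain ⟨t, ht, hnd, -⟩ := exists_exponentOf_nodup pi.2.parts
  have hpos : ∀ (rho : Σ n : ℕ, n.Partition) (u : Multiset (ℕ × ℕ)),
      u.map Prod.snd = rho.2.parts → ∀ x ∈ u, x.2 ≠ 0 := by
    intro rho u hu x hx
    exact (rho.2.parts_pos (hu ▸ Multiset.mem_map_of_mem _ hx)).ne'
  have hcoeff := congrArg (MvPowerSeries.coeff (exponentOf t)) hc
  rw [Finsupp.linearCombination_apply, Finsupp.sum, map_sum, map_zero,
    Finset.sum_eq_single_of_mem pi hpi] at hcoeff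
  · rw [map_smul, smul_eq_mul] at hcoeff
    have h1 := coeff_exponentOf_pos t
    rw [ht] at h1
    exact mul_ne_zero (Finsupp.mem_support_iff.1 hpi) h1.ne' hcoeff
  · intro rho hrho hrne
    rw [map_smul, smul_eq_mul]
    refine mul_eq_zero_of_right _ ?_
    by_contra h0
    obtain ⟨u, hu, hsum⟩ := exists_exponentOf_of_coeff_ne_zero _ _ h0
    have hcard : u.card ≤ t.card := by
      have := hmax rho hrho
      rwa [← hu, ← ht, Multiset.card_map, Multiset.card_map] at this
    have heq := map_snd_eq_of_exponentOf_eq hnd (hpos pi t ht) (hpos rho u hu) hcard hsum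
    rw [hu, ht] at heq
    apply hrne
    obtain ⟨n, rho⟩ := rho
    obtain ⟨k, pi⟩ := pi
    dsimp only at heq
    obtain rfl : n = k := by rw [← rho.parts_sum, ← pi.parts_sum, heq]
    rw [Nat.Partition.ext heq]

/-! ### Strips and double strips in terms of parts -/

namespace StrictPartition

/-- `d` is one of the entries of the sequence `λ₁, λ₂, …`. -/
def HasPart (lam : StrictPartition) (d : ℕ) : Prop := ∃ i, lam.part i = d

theorem mem_shifted_diagonal (lam : StrictPartition) (d : ℕ) (c : ℕ × ℕ) :
    c ∈ diagonal lam.shifted d ↔ c.2 = c.1 + d ∧ d < lam.part c.1 := by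
  rw [diagonal, Finset.mem_filter, mem_shifted]
  omega

theorem part_injective (lam : StrictPartition) {i j : ℕ} (h : lam.part i = lam.part j)
    (h0 : lam.part i ≠ 0) : i = j := by
  rcases lt_trichotomy i j with hij | hij | hij
  · have := lam.part_lt hij (h ▸ h0)
    omega
  · exact hij
  · have := lam.part_lt hij h0
    omega

-- Row i meets diagonal d exactly when its length exceeds d. Diagonals d and d + 1 thus differ by
-- the rows of length d + 1, of which strictness allows at most one.
open Classical in
theorem card_shifted_diagonal (lam : StrictPartition) (d : ℕ) :
    (diagonal lam.shifted d).card =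
      (diagonal lam.shifted (d + 1)).card + if lam.HasPart (d + 1) then 1 else 0 := by
  have hrow : ∀ e, (diagonal lam.shifted e).card =
      ((Finset.range (lam.part 0)).filter (fun i => e < lam.part i)).card := by
    intro e
    symm
    refine Finset.card_bij (fun i _ => (i, i + e)) ?_ ?_ ?_
    · intro i hi
      rw [mem_shifted_diagonal]
      exact ⟨rfl, (Finset.mem_filter.1 hi).2⟩
    · intro i _ j _ h
      exact congrArg Prod.fst h
    · intro c hc
      rw [mem_shifted_diagonal] at hc
      have := lam.part_add_le c.1 (by omega)
      refine ⟨c.1, Finset.mem_filter.2 ⟨Finset.mem_range.2 (by omega), hc.2⟩, ?_⟩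
      exact Prod.ext rfl hc.1.symm
  rw [hrow, hrow]
  split_ifs with h
  · obtain ⟨i, hi⟩ := h
    have hle := lam.part_add_le i (by omega)
    rw [← Finset.card_insert_of_notMem (a := i)]
    · congr 1
      ext j
      simp only [Finset.mem_filter, Finset.mem_range, Finset.mem_insert]
      constructor
      · rintro ⟨h1, h2⟩
        rcases Nat.lt_or_ge (d + 1) (lam.part j) with h3 | h3
        · exact Or.inr ⟨h1, h3⟩
        · exact Or.inl (lam.part_injective (by omega) (by omega))
      · rintro (rfl | ⟨h1, h2⟩)
        · omega
        · omega
    · simp [hi]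
  · rw [add_zero]
    congr 1
    refine Finset.filter_congr fun j _ => ?_
    have : lam.part j ≠ d + 1 := fun e => h ⟨j, e⟩
    omega

end StrictPartition

theorem card_diagonal_skewShifted {lam mu : StrictPartition} (h : mu ≤ lam) (d : ℕ) :
    (diagonal lam.shifted d).card =
      (diagonal mu.shifted d).card + (diagonal (skewShifted lam mu) d).card := by
  have hd : diagonal (skewShifted lam mu) d = diagonal lam.shifted d \ diagonal mu.shifted d := by
    ext c
    simp only [diagonal, skewShifted, Finset.mem_filter, Finset.mem_sdiff]
    tauto
  have hsub : diagonal mu.shifted d ⊆ diagonal lam.shifted d := by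
    intro c hc
    rw [StrictPartition.mem_shifted_diagonal] at hc ⊢
    exact ⟨hc.1, hc.2.trans_le (h c.1)⟩
  rw [hd, Finset.card_sdiff_of_subset hsub]
  have := Finset.card_le_card hsub
  omega

/-- The diagonals met by a path of adjacent squares form an interval. -/
theorem exists_diagonal_of_path {D : Finset (ℕ × ℕ)} (hD : ∀ c ∈ D, c.1 ≤ c.2) {a b : ℕ × ℕ}
    (ha : a ∈ D) (hab : Relation.ReflTransGen (fun x y => y ∈ D ∧ RookAdj x y) a b) (e : ℕ)
    (h1 : min (a.2 - a.1) (b.2 - b.1) ≤ e) (h2 : e ≤ max (a.2 - a.1) (b.2 - b.1)) :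
    ∃ c ∈ D, c.2 = c.1 + e := by
  suffices b ∈ D ∧ ∀ e, min (a.2 - a.1) (b.2 - b.1) ≤ e → e ≤ max (a.2 - a.1) (b.2 - b.1) →
      ∃ c ∈ D, c.2 = c.1 + e from this.2 e h1 h2
  clear h1 h2 e
  induction hab with
  | refl =>
    refine ⟨ha, fun e h1 h2 => ⟨a, ha, ?_⟩⟩
    have := hD a ha
    omega
  | @tail x y _ hxy ih =>
    refine ⟨hxy.1, fun e h1 h2 => ?_⟩
    have hx := hD x ih.1
    have hy := hD y hxy.1
    have hadj := hxy.2
    rw [RookAdj] at hadj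
    -- Adjacent squares lie on neighbouring diagonals, so passing from `x` to `y` adds at most the
    -- diagonal of `y` to the interval.
    by_cases hye : y.2 = y.1 + e
    · exact ⟨y, hxy.1, hye⟩
    · exact ih.2 e (by omega) (by omega)

open Classical in
/-- A strip meets the diagonals of an interval `[p, q)`, each of them in one square. -/
theorem IsStrip.exists_interval {lam mu : StrictPartition} (h : IsStrip lam mu) :
    ∃ p q : ℕ, p < q ∧ q = p + (skewShifted lam mu).card ∧
      ∀ d, (diagonal (skewShifted lam mu) d).card = if p ≤ d ∧ d < q then 1 else 0 := by
  obtain ⟨⟨hne, hconn⟩, hdiag⟩ := h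
  set D := skewShifted lam mu
  have hD : ∀ c ∈ D, c.1 ≤ c.2 := by
    intro c hc
    exact ((lam.mem_shifted c).1 (Finset.mem_sdiff.1 hc).1).1
  obtain ⟨a, ha, hmin⟩ := D.exists_min_image (fun c => c.2 - c.1) hne
  obtain ⟨b, hb, hmax⟩ := D.exists_max_image (fun c => c.2 - c.1) hne
  have hab := hmin b hb
  have himage : D.image (fun c => c.2 - c.1) = Finset.Ico (a.2 - a.1) (b.2 - b.1 + 1) := by
    ext e
    rw [Finset.mem_image, Finset.mem_Ico]
    constructor
    · rintro ⟨c, hc, rfl⟩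
      have h1 := hmin c hc
      have h2 := hmax c hc
      omega
    · rintro ⟨h1, h2⟩
      obtain ⟨c, hc, he⟩ := exists_diagonal_of_path hD ha (hconn a ha b hb) e (by omega) (by omega)
      exact ⟨c, hc, by omega⟩
  -- With one square per diagonal, the squares are counted by the diagonals met, which gives q = p +
  -- |λ/μ|.
  have hinj : Set.InjOn (fun c : ℕ × ℕ => c.2 - c.1) D := by
    intro c hc e he hce
    have h1 := hD c hc
    have h2 := hD e he
    dsimp only at hce
    refine Finset.card_le_one.1 (hdiag (c.2 - c.1)) c ?_ e ?_ <;>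
      refine Finset.mem_filter.2 ⟨by assumption, by omega⟩
  have hcard := Finset.card_image_of_injOn hinj
  rw [himage, Nat.card_Ico] at hcard
  refine ⟨a.2 - a.1, b.2 - b.1 + 1, by omega, by omega, fun d => ?_⟩
  split_ifs with hd
  · rw [← Finset.mem_Ico, ← himage, Finset.mem_image] at hd
    obtain ⟨c, hc, rfl⟩ := hd
    have h1 := hD c hc
    refine le_antisymm (hdiag _) (Finset.card_pos.2 ⟨c, Finset.mem_filter.2 ⟨hc, by omega⟩⟩)
  · rw [Finset.card_eq_zero, Finset.eq_empty_iff_forall_notMem]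
    intro c hc
    rw [diagonal, Finset.mem_filter] at hc
    rw [← Finset.mem_Ico, ← himage] at hd
    exact hd (Finset.mem_image.2 ⟨c, hc.1, by omega⟩)

/-- Removing a strip replaces a part `q` by a smaller number `p`, which is `0` if the strip
contains a square `(j, j)`. -/
theorem IsStrip.hasPart {lam mu : StrictPartition} (hle : mu ≤ lam) (h : IsStrip lam mu) :
    ∃ p q : ℕ, q = p + (skewShifted lam mu).card ∧ lam.HasPart q ∧ (p ≠ 0 → ¬ lam.HasPart p) ∧
      ((diagonal (skewShifted lam mu) 0).Nonempty → p = 0) ∧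
      ∀ d ≠ 0, (mu.HasPart d ↔ (lam.HasPart d ∧ d ≠ q) ∨ d = p) := by
  classical
  obtain ⟨p, q, hpq, hcard, hd⟩ := h.exists_interval
  -- Subtracting the counts on diagonals d and d + 1 turns the indicator of [p, q) into that of d +
  -- 1 = q minus that of d + 1 = p.
  have key : ∀ d, (if lam.HasPart (d + 1) then 1 else 0) + (if d + 1 = p then 1 else 0) =
      (if mu.HasPart (d + 1) then 1 else 0) + (if d + 1 = q then 1 else 0) := by
    intro d
    have h1 := lam.card_shifted_diagonal d
    have h2 := mu.card_shifted_diagonal d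
    have h3 := card_diagonal_skewShifted hle d
    have h4 := card_diagonal_skewShifted hle (d + 1)
    rw [hd] at h3 h4
    split_ifs at * <;> omega
  refine ⟨p, q, hcard, ?_, ?_, ?_, ?_⟩
  · obtain ⟨d, rfl⟩ := Nat.exists_eq_succ_of_ne_zero (by omega : q ≠ 0)
    have := key d
    by_contra hcon
    simp only [Nat.succ_eq_add_one, if_neg hcon] at this
    split_ifs at this <;> omega
  · intro hp hcon
    obtain ⟨d, rfl⟩ := Nat.exists_eq_succ_of_ne_zero hp
    have := key d
    simp only [Nat.succ_eq_add_one, if_pos hcon] at this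
    split_ifs at this <;> omega
  · intro h0
    have h1 := Finset.card_pos.2 h0
    rw [hd] at h1
    split_ifs at h1 with h2 <;> omega
  · intro d hd0
    obtain ⟨d, rfl⟩ := Nat.exists_eq_succ_of_ne_zero hd0
    have := key d
    rw [Nat.succ_eq_add_one]
    by_cases hl : lam.HasPart (d + 1) <;> by_cases hm : mu.HasPart (d + 1) <;>
      simp only [hl, hm, if_true, if_false, true_and, false_and, true_iff, false_iff,
        false_or] at this ⊢ <;> split_ifs at this <;> omega

/-- Removing a double strip removes two parts. -/
theorem IsDoubleStrip.hasPart {lam mu : StrictPartition} (h : IsDoubleStrip lam mu) :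
    ∃ q r : ℕ, q ≠ 0 ∧ r ≠ 0 ∧ q ≠ r ∧ q + r = (skewShifted lam mu).card ∧
      lam.HasPart q ∧ lam.HasPart r ∧
      ∀ d ≠ 0, (mu.HasPart d ↔ lam.HasPart d ∧ d ≠ q ∧ d ≠ r) := by
  obtain ⟨nu, hmn, hnl, hs, hs', hd, hd'⟩ := h
  -- A strip that meets the main diagonal has p = 0, so it only deletes a part, whose size is its
  -- number of squares.
  have aux : ∀ {a b : StrictPartition}, b ≤ a → IsStrip a b →
      (diagonal (skewShifted a b) 0).Nonempty → ∃ q ≠ 0, q = (skewShifted a b).card ∧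
        a.HasPart q ∧ ∀ d ≠ 0, (b.HasPart d ↔ a.HasPart d ∧ d ≠ q) := by
    intro a b hab hst h0
    obtain ⟨p, q, hq, haq, -, hp, hb⟩ := hst.hasPart hab
    obtain rfl := hp h0
    obtain ⟨c, hc⟩ := h0
    have hpos := Finset.card_pos.2 ⟨c, (Finset.mem_filter.1 hc).1⟩
    refine ⟨q, by omega, by omega, haq, fun d hd0 => ?_⟩
    rw [hb d hd0, or_iff_left hd0]
  obtain ⟨q, hq0, hq, hlq, hq'⟩ := aux hnl hs hd
  obtain ⟨r, hr0, hr, hnr, hr'⟩ := aux hmn hs' hd'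
  -- The parts of `nu` are those of `lam` other than `q`, so `r` is a second part of `lam`.
  obtain ⟨hlr, hrq⟩ := (hq' r hr0).1 hnr
  refine ⟨q, r, hq0, hr0, hrq.symm, ?_, hlq, hlr, fun d hd0 => ?_⟩
  · have hsub : ∀ {a b : StrictPartition}, b ≤ a → b.shifted ⊆ a.shifted := by
      intro a b hab c hc
      rw [StrictPartition.mem_shifted] at hc ⊢
      have := hab c.1
      omega
    have h1 := Finset.card_sdiff_add_card_eq_card (hsub hnl)
    have h2 := Finset.card_sdiff_add_card_eq_card (hsub hmn)
    have h3 := Finset.card_sdiff_add_card_eq_card ((hsub hmn).trans (hsub hnl))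
    simp only [skewShifted] at hq hr ⊢
    omega
  · rw [hr' d hd0, hq' d hd0, and_assoc]

/-! ### From chains of row lengths to skew bar tableaux -/

/-- The positive values of `r` are distinct, and they are the parts of `λ`. -/
structure IsArrangement (r : ℕ → ℕ) (lam : StrictPartition) : Prop where
  eq_zero : ∀ i j, i ≠ j → r i = r j → r i = 0
  mem : ∀ d ≠ 0, lam.HasPart d ↔ ∃ i, r i = d

/-- The row lengths `r'` arise from `r` by the removal of a bar with an odd number of squares. -/
def RemovesBar (r' r : ℕ → ℕ) : Prop :=
  (∃ i p, p < r i ∧ Odd (r i - p) ∧ r' = Function.update r i p) ∨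
    ∃ i j, i ≠ j ∧ r i ≠ 0 ∧ r j ≠ 0 ∧ Odd (r i + r j) ∧
      r' = Function.update (Function.update r i 0) j 0

theorem StrictPartition.isArrangement (lam : StrictPartition) : IsArrangement lam.part lam where
  eq_zero i j hij h := by
    by_contra h0
    exact hij (lam.part_injective h h0)
  mem _ _ := Iff.rfl

theorem RemovesBar.le {r' r : ℕ → ℕ} (h : RemovesBar r' r) (i : ℕ) : r' i ≤ r i := by
  rcases h with ⟨j, p, hp, -, rfl⟩ | ⟨j, k, -, -, -, -, rfl⟩ <;>
    simp only [Function.update_apply] <;> split_ifs <;> subst_vars <;> omega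

/-- The bar is removed in place: a strip shortens the row of length q to p, a double strip empties
two rows. The size of the step is q - p or q + s, whence the parity. -/
theorem IsArrangement.exists_removesBar {r : ℕ → ℕ} {lam mu : StrictPartition}
    (hr : IsArrangement r lam) (hle : mu ≤ lam) (hodd : Odd (skewShifted lam mu).card)
    (h : IsStrip lam mu ∨ IsDoubleStrip lam mu) :
    ∃ r', IsArrangement r' mu ∧ RemovesBar r' r := by
  have hpos := hodd.pos
  rcases h with h | h
  · obtain ⟨p, q, hq, hlq, hp, -, hmu⟩ := h.hasPart hle
    obtain ⟨i, rfl⟩ := (hr.mem q (by omega)).1 hlq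
    refine ⟨Function.update r i p, ⟨?_, ?_⟩, Or.inl ⟨i, p, by omega, ?_, rfl⟩⟩
    · have aux : ∀ j, j ≠ i → p = r j → p = 0 := by
        intro j _ hj
        by_contra hp0
        exact hp hp0 ((hr.mem p hp0).2 ⟨j, hj.symm⟩)
      intro j k hjk
      simp only [Function.update_apply]
      split_ifs with h1 h2 h2
      · omega
      · exact aux k h2
      · intro he
        rw [he]
        exact aux j h1 he.symm
      · exact hr.eq_zero j k hjk
    · intro d hd
      rw [hmu d hd, hr.mem d hd]
      constructor
      · rintro (⟨⟨j, rfl⟩, hj⟩ | rfl)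
        · exact ⟨j, Function.update_of_ne (fun e => hj (congrArg r e)) _ _⟩
        · exact ⟨i, Function.update_self _ _ _⟩
      · rintro ⟨j, hj⟩
        rw [Function.update_apply] at hj
        split_ifs at hj with h1
        · exact Or.inr hj.symm
        · subst hj
          exact Or.inl ⟨⟨j, rfl⟩, fun e => hd (hr.eq_zero j i h1 e)⟩
    · rwa [hq, Nat.add_sub_cancel_left]
  · obtain ⟨q, s, hq0, hs0, hqs, hcard, hq, hs, hmu⟩ := h.hasPart
    obtain ⟨i, rfl⟩ := (hr.mem q hq0).1 hq
    obtain ⟨j, rfl⟩ := (hr.mem s hs0).1 hs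
    have hij : i ≠ j := fun e => hqs (e ▸ rfl)
    refine ⟨_, ⟨?_, ?_⟩, Or.inr ⟨i, j, hij, hq0, hs0, hcard ▸ hodd, rfl⟩⟩
    · intro k l hkl
      have := hr.eq_zero k l hkl
      simp only [Function.update_apply]
      split_ifs <;> omega
    · intro d hd
      rw [hmu d hd, hr.mem d hd]
      constructor
      · rintro ⟨⟨k, rfl⟩, h1, h2⟩
        refine ⟨k, ?_⟩
        rw [Function.update_of_ne (fun e => h2 (congrArg r e)),
          Function.update_of_ne (fun e => h1 (congrArg r e))]
      · rintro ⟨k, hk⟩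
        simp only [Function.update_apply] at hk
        split_ifs at hk with h1 h2
        · exact absurd hk.symm hd
        · exact absurd hk.symm hd
        · subst hk
          exact ⟨⟨k, rfl⟩, fun e => hd (hr.eq_zero k i h2 e), fun e => hd (hr.eq_zero k j h1 e)⟩

/-- The order of the rows is prescribed only at the top; each lower arrangement depends on the one
above it, so the chain is built downwards. -/
theorem exists_chain_of_arrangements (k : ℕ) (shape : ℕ → StrictPartition)
    (hstep : ∀ a < k, ∀ r, IsArrangement r (shape (a + 1)) →
      ∃ r', IsArrangement r' (shape a) ∧ RemovesBar r' r)
    (r : ℕ → ℕ) (hr : IsArrangement r (shape k)) :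
    ∃ R : ℕ → ℕ → ℕ, R k = r ∧ (∀ a ≤ k, IsArrangement (R a) (shape a)) ∧
      ∀ a < k, RemovesBar (R a) (R (a + 1)) := by
  induction k generalizing r with
  | zero =>
    refine ⟨fun _ => r, rfl, fun a ha => ?_, fun a ha => absurd ha (Nat.not_lt_zero a)⟩
    rwa [Nat.le_zero.1 ha]
  | succ k ih =>
    obtain ⟨r', hr', hbar⟩ := hstep k (Nat.lt_succ_self k) r hr
    obtain ⟨R, hRk, hR, hRb⟩ := ih (fun a ha => hstep a (ha.trans (Nat.lt_succ_self k))) r' hr'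
    refine ⟨Function.update R (k + 1) r, Function.update_self _ _ _, ?_, ?_⟩
    · intro a ha
      rcases ha.lt_or_eq with ha | rfl
      · rw [Function.update_of_ne ha.ne]
        exact hR a (by omega)
      · rwa [Function.update_self]
    · intro a ha
      rw [Function.update_of_ne ha.ne]
      rcases (Nat.lt_succ_iff.1 ha).lt_or_eq with ha | rfl
      · rw [Function.update_of_ne (by omega)]
        exact hRb a ha
      · rwa [Function.update_self, hRk]

/-- Functions with finite supports that take the same positive values, each of them once, differ by
a permutation. -/
theorem IsArrangement.exists_perm {r : ℕ → ℕ} {mu : StrictPartition} (hr : IsArrangement r mu)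
    (hfin : {i | r i ≠ 0}.Finite) : ∃ s : Equiv.Perm ℕ, ∀ i, r (s i) = mu.part i := by
  classical
  have hfin' : {i | mu.part i ≠ 0}.Finite := by
    refine (Set.finite_lt_nat (mu.part 0)).subset fun i hi => ?_
    have := mu.part_add_le i hi
    have hi' : mu.part i ≠ 0 := hi
    change i < mu.part 0
    omega
  have hex : ∀ x : {i // mu.part i ≠ 0}, ∃ y : {i // r i ≠ 0}, r y.1 = mu.part x.1 := by
    intro x
    obtain ⟨y, hy⟩ := (hr.mem _ x.2).1 ⟨x.1, rfl⟩
    exact ⟨⟨y, hy ▸ x.2⟩, hy⟩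
  choose f hf using hex
  have hbij : Function.Bijective f := by
    constructor
    · intro x y hxy
      have h := hf x
      rw [hxy, hf y] at h
      exact Subtype.ext (mu.part_injective h.symm x.2)
    · intro y
      obtain ⟨i, hi⟩ := (hr.mem _ y.2).2 ⟨y.1, rfl⟩
      refine ⟨⟨i, hi ▸ y.2⟩, Subtype.ext ?_⟩
      by_contra hne
      have h := hf ⟨i, hi ▸ y.2⟩
      exact (f _).2 (hr.eq_zero _ _ hne (h.trans hi))
  -- The zero positions on both sides are countably infinite, so a bijection between them completes
  -- `f` to a permutation.
  have : Infinite {i // ¬ mu.part i ≠ 0} := hfin'.infinite_compl.to_subtype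
  have : Infinite {i // ¬ r i ≠ 0} := hfin.infinite_compl.to_subtype
  obtain ⟨g⟩ := nonempty_equiv_of_countable (α := {i // ¬ mu.part i ≠ 0})
    (β := {i // ¬ r i ≠ 0})
  refine ⟨Equiv.subtypeCongr (Equiv.ofBijective f hbij) g, fun i => ?_⟩
  by_cases hi : mu.part i ≠ 0
  · have : Equiv.subtypeCongr (Equiv.ofBijective f hbij) g i = (f ⟨i, hi⟩).1 := by
      simp [Equiv.subtypeCongr, hi]
    rw [this, hf]
  · have h1 : Equiv.subtypeCongr (Equiv.ofBijective f hbij) g i = (g ⟨i, hi⟩).1 := by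
      simp [Equiv.subtypeCongr, hi]
    rw [h1, not_not.1 (g ⟨i, hi⟩).2, not_not.1 hi]

/-- The filling of `S(λ)` whose entries at most `a` are the first `R a i` squares of each
row `i`. -/
noncomputable def fillingOf (lam : StrictPartition) (R : ℕ → ℕ → ℕ) (c : ℕ × ℕ) : ℕ :=
  if c ∈ lam.shifted then sInf {a | c.2 - c.1 < R a c.1} else 0

theorem fillingOf_le_iff {lam : StrictPartition} {R : ℕ → ℕ → ℕ} {k : ℕ} (hmono : Monotone R)
    (hk : R k = lam.part) {i t : ℕ} (ht : t < lam.part i) (a : ℕ) :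
    fillingOf lam R (i, i + t) ≤ a ↔ t < R a i := by
  rw [fillingOf, if_pos ((lam.mem_shifted _).2 ⟨by simp, by simpa using ht⟩)]
  simp only [Nat.add_sub_cancel_left]
  constructor
  · intro h
    -- Nonemptiness rules out the default value `sInf ∅ = 0`; the top level `k` contains every
    -- square.
    have hne : {b | t < R b i}.Nonempty := ⟨k, by rwa [Set.mem_ofPred_eq, hk]⟩
    exact (Nat.sInf_mem hne).trans_le (hmono h i)
  · intro h
    exact Nat.sInf_le h

theorem fillingOf_eq_succ_iff {lam : StrictPartition} {R : ℕ → ℕ → ℕ} {k : ℕ} (hmono : Monotone R)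
    (hk : R k = lam.part) {i t : ℕ} (ht : t < lam.part i) (a : ℕ) :
    fillingOf lam R (i, i + t) = a + 1 ↔ R a i ≤ t ∧ t < R (a + 1) i := by
  have h1 := fillingOf_le_iff hmono hk ht a
  have h2 := fillingOf_le_iff hmono hk ht (a + 1)
  omega

/-- The part of row `i` of `S(λ)` that consists of the squares `(i, i + t)` with `p ≤ t < q`. -/
def rowSegment (i p q : ℕ) : Finset (ℕ × ℕ) := (Finset.Ico p q).image (fun t => (i, i + t))

theorem mem_rowSegment {i p q : ℕ} {c : ℕ × ℕ} :
    c ∈ rowSegment i p q ↔ c.1 = i ∧ ∃ t, c = (i, i + t) ∧ p ≤ t ∧ t < q := by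
  simp only [rowSegment, Finset.mem_image, Finset.mem_Ico]
  constructor
  · rintro ⟨t, ht, rfl⟩
    exact ⟨rfl, t, rfl, ht⟩
  · rintro ⟨-, t, rfl, ht⟩
    exact ⟨t, ht, rfl⟩

theorem card_rowSegment (i p q : ℕ) : (rowSegment i p q).card = q - p := by
  rw [rowSegment, Finset.card_image_of_injective, Nat.card_Ico]
  intro s t hst
  simpa using hst

/-- Here `s` is any finite set containing the rows that change at this step. For the one or two rows
of a `RemovesBar`, this gives the size of the bar and the rows it meets. -/
theorem filter_fillingOf_eq {lam : StrictPartition} {R : ℕ → ℕ → ℕ} {k : ℕ} (hmono : Monotone R)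
    (hk : R k = lam.part) (hle : ∀ a i, R a i ≤ lam.part i) (a : ℕ) (s : Finset ℕ)
    (hs : ∀ i ∉ s, R a i = R (a + 1) i) :
    lam.shifted.filter (fun c => fillingOf lam R c = a + 1) =
      s.biUnion (fun i => rowSegment i (R a i) (R (a + 1) i)) := by
  ext ⟨i, j⟩
  simp only [Finset.mem_filter, Finset.mem_biUnion, mem_rowSegment]
  constructor
  · rintro ⟨hc, he⟩
    have hc' := (lam.mem_shifted _).1 hc
    dsimp only at hc'
    obtain ⟨t, rfl⟩ := Nat.exists_eq_add_of_le hc'.1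
    have h1 := (fillingOf_eq_succ_iff hmono hk (by omega) a).1 he
    refine ⟨i, ?_, rfl, t, rfl, h1⟩
    by_contra hi
    have := hs i hi
    omega
  · rintro ⟨i, hi, rfl, t, h, h1, h2⟩
    have := hle (a + 1) i
    simp only [Prod.mk.injEq, true_and] at h
    subst h
    exact ⟨(lam.mem_shifted _).2 ⟨by simp, by simp; omega⟩,
      (fillingOf_eq_succ_iff hmono hk (by omega) a).2 ⟨h1, h2⟩⟩

theorem card_filter_fillingOf {lam : StrictPartition} {R : ℕ → ℕ → ℕ} {k : ℕ} (hmono : Monotone R)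
    (hk : R k = lam.part) (hle : ∀ a i, R a i ≤ lam.part i) (a : ℕ) (s : Finset ℕ)
    (hs : ∀ i ∉ s, R a i = R (a + 1) i) :
    (lam.shifted.filter (fun c => fillingOf lam R c = a + 1)).card =
      ∑ i ∈ s, (R (a + 1) i - R a i) := by
  rw [filter_fillingOf_eq hmono hk hle a s hs, Finset.card_biUnion]
  · exact Finset.sum_congr rfl fun i _ => card_rowSegment _ _ _
  · intro i _ j _ hij
    refine Finset.disjoint_left.2 fun c hc hc' => hij ?_
    rw [mem_rowSegment] at hc hc'
    exact hc.1.symm.trans hc'.1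

/-- A chain of row lengths, each obtained from the next one by the removal of an odd bar, is a skew
bar tableau. -/
theorem exists_skewBarTableau_of_chain {lam mu : StrictPartition} (k : ℕ) (R : ℕ → ℕ → ℕ)
    (hk : ∀ a, k ≤ a → R a = lam.part) (hbar : ∀ a < k, RemovesBar (R a) (R (a + 1)))
    (hdistinct : ∀ a i j, i ≠ j → R a i = R a j → R a i = 0) (h0 : IsArrangement (R 0) mu) :
    ∃ T : SkewBarTableau lam mu, T.numBars ≤ k := by
  classical
  have hmono : Monotone R := by
    refine monotone_nat_of_le_succ fun a => ?_
    rcases Nat.lt_or_ge a k with ha | ha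
    · exact (hbar a ha).le
    · rw [hk a ha, hk (a + 1) (by omega)]
  have hkk := hk k le_rfl
  have hle : ∀ a i, R a i ≤ lam.part i := by
    intro a i
    rcases le_total a k with ha | ha
    · exact hkk ▸ hmono ha i
    · rw [hk a ha]
  -- Conditions (4) and (5) thereby become statements about the chain `R`.
  have hrow : ∀ a i, rowLength lam (fillingOf lam R) a i = R a i := fun a i =>
    rowLength_eq lam _ a i _ (hle a i) fun t ht => fillingOf_le_iff hmono hkk ht a
  have hbound : ∀ c ∈ lam.shifted, fillingOf lam R c ≤ k := by
    rintro ⟨i, j⟩ hc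
    have hc' := (lam.mem_shifted _).1 hc
    dsimp only at hc'
    obtain ⟨t, rfl⟩ := Nat.exists_eq_add_of_le hc'.1
    rw [fillingOf_le_iff hmono hkk (by omega), hkk]
    omega
  have hpos : ∀ a, 0 < a → ∀ c ∈ lam.shifted, fillingOf lam R c = a →
      ∃ b < k, a = b + 1 := by
    intro a ha c hc hca
    have := hbound c hc
    exact ⟨a - 1, by omega, by omega⟩
  have hmem : ∀ b (s : Finset ℕ), (∀ i ∉ s, R b i = R (b + 1) i) → ∀ c ∈ lam.shifted,
      fillingOf lam R c = b + 1 → c.1 ∈ s := by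
    intro b s hs c hc he
    have h1 : c ∈ lam.shifted.filter (fun c => fillingOf lam R c = b + 1) :=
      Finset.mem_filter.2 ⟨hc, he⟩
    rw [filter_fillingOf_eq hmono hkk hle b s hs, Finset.mem_biUnion] at h1
    obtain ⟨i, hi, h2⟩ := h1
    rw [mem_rowSegment] at h2
    exact h2.1 ▸ hi
  refine ⟨⟨fillingOf lam R, ?_, ?_, ?_, ?_, ?_, ?_, ?_⟩, ?_⟩
  · intro c hc
    rw [fillingOf, if_neg hc]
  · intro i j l hj hl hjl
    have hj' := (lam.mem_shifted _).1 hj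
    have hl' := (lam.mem_shifted _).1 hl
    dsimp only at hj' hl'
    obtain ⟨t, rfl⟩ := Nat.exists_eq_add_of_le hj'.1
    obtain ⟨u, rfl⟩ := Nat.exists_eq_add_of_le hl'.1
    rw [fillingOf_le_iff hmono hkk (by omega)]
    have := (fillingOf_le_iff hmono hkk (t := u) (i := i) (by omega) _).1 le_rfl
    omega
  · rintro a ha ⟨c, hc, hca⟩
    obtain ⟨b, hb, rfl⟩ := hpos a ha c hc hca
    rcases hbar b hb with ⟨i, p, hp, hodd, he⟩ | ⟨i, j, hij, hi, hj, hodd, he⟩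
    · rw [card_filter_fillingOf hmono hkk hle b {i}, Finset.sum_singleton, he,
        Function.update_self]
      · exact hodd
      · intro l hl
        rw [he, Function.update_of_ne (by simpa using hl)]
    · rw [card_filter_fillingOf hmono hkk hle b {i, j}, Finset.sum_pair hij, he,
        Function.update_self, Function.update_of_ne hij, Function.update_self]
      · exact hodd
      · intro l hl
        simp only [Finset.mem_insert, Finset.mem_singleton, not_or] at hl
        rw [he, Function.update_of_ne hl.2, Function.update_of_ne hl.1]
  · intro a ha
    by_cases hex : ∃ c ∈ lam.shifted, fillingOf lam R c = a
    · obtain ⟨c, hc, hca⟩ := hex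
      obtain ⟨b, hb, rfl⟩ := hpos a ha c hc hca
      obtain ⟨s, hs, hcard⟩ : ∃ s : Finset ℕ, (∀ i ∉ s, R b i = R (b + 1) i) ∧ s.card ≤ 2 := by
        rcases hbar b hb with ⟨i, p, -, -, he⟩ | ⟨i, j, -, -, -, -, he⟩
        · refine ⟨{i}, fun l hl => ?_, by simp⟩
          rw [he, Function.update_of_ne (by simpa using hl)]
        · refine ⟨{i, j}, fun l hl => ?_, Finset.card_le_two⟩
          simp only [Finset.mem_insert, Finset.mem_singleton, not_or] at hl
          rw [he, Function.update_of_ne hl.2, Function.update_of_ne hl.1]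
      refine (Finset.card_le_card (Finset.image_subset_iff.2 fun d hd => ?_)).trans hcard
      rw [Finset.mem_filter] at hd
      exact hmem b s hs d hd.1 hd.2
    · rw [Finset.filter_eq_empty_iff.2 fun c hc hca => hex ⟨c, hc, hca⟩]
      simp
  · intro a ha c hc d hd hca hda hcd
    obtain ⟨b, hb, rfl⟩ := hpos a ha c hc hca
    rcases hbar b hb with ⟨i, p, -, -, he⟩ | ⟨i, j, hij, hi, hj, -, he⟩
    · have hs : ∀ l ∉ ({i} : Finset ℕ), R b l = R (b + 1) l := by
        intro l hl
        rw [he, Function.update_of_ne (by simpa using hl)]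
      have h1 := hmem b _ hs c hc hca
      have h2 := hmem b _ hs d hd hda
      rw [Finset.mem_singleton] at h1 h2
      exact absurd (h1.trans h2.symm) hcd
    · have hs : ∀ l ∉ ({i, j} : Finset ℕ), R b l = R (b + 1) l := by
        intro l hl
        simp only [Finset.mem_insert, Finset.mem_singleton, not_or] at hl
        rw [he, Function.update_of_ne hl.2, Function.update_of_ne hl.1]
      -- A bar in two rows empties both of them, so it contains their first squares, t = 0.
      have hbegin : ∀ l ∈ ({i, j} : Finset ℕ), fillingOf lam R (l, l) = b + 1 := by
        intro l hl
        have h1 : R b l = 0 ∧ R (b + 1) l ≠ 0 := by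
          simp only [Finset.mem_insert, Finset.mem_singleton] at hl
          rcases hl with rfl | rfl
          · exact ⟨by rw [he, Function.update_of_ne hij, Function.update_self], hi⟩
          · exact ⟨by rw [he, Function.update_self], hj⟩
        have h2 := hle (b + 1) l
        exact (fillingOf_eq_succ_iff hmono hkk (i := l) (t := 0) (by omega) b).2 (by omega)
      exact ⟨hbegin _ (hmem b _ hs c hc hca), hbegin _ (hmem b _ hs d hd hda)⟩
  · intro a i j hij h
    rw [hrow, hrow] at h
    rw [hrow]
    exact hdistinct a i j hij h
  · simp only [hrow]
    refine h0.exists_perm ((Set.finite_lt_nat (lam.part 0)).subset fun i hi => ?_)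
    have hi' : R 0 i ≠ 0 := hi
    have h1 := hle 0 i
    have h2 := lam.part_add_le i (by omega)
    change i < lam.part 0
    omega
  · have hsub : (lam.shifted.image (fillingOf lam R)).filter (fun a => 0 < a) ⊆
        Finset.Icc 1 k := by
      intro a ha
      rw [Finset.mem_filter, Finset.mem_image] at ha
      obtain ⟨⟨c, hc, rfl⟩, h1⟩ := ha
      exact Finset.mem_Icc.2 ⟨h1, hbound c hc⟩
    simpa [SkewBarTableau.numBars] using Finset.card_le_card hsub

/-! ### The degree of the terms of `Q_{λ/μ}` -/

/-- A strip tableau with odd strips gives a skew bar tableau with at most as many bars. -/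
theorem StripTableau.srank_le {lam mu : StrictPartition} {l : List ℕ} (T : StripTableau lam mu l)
    (hodd : ∀ x ∈ l, Odd x) : srank lam mu ≤ l.length := by
  set k := l.length
  let shape : ℕ → StrictPartition := fun a => if h : a < k + 1 then T.shape ⟨a, h⟩ else lam
  have hshape : ∀ (a : ℕ) (h : a < k + 1), shape a = T.shape ⟨a, h⟩ := fun a h => dif_pos h
  have hlast : shape k = lam := (hshape k (Nat.lt_succ_self k)).trans T.last
  have hfirst : shape 0 = mu := (hshape 0 (Nat.succ_pos k)).trans T.first
  have hstep : ∀ a < k, ∀ r, IsArrangement r (shape (a + 1)) →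
      ∃ r', IsArrangement r' (shape a) ∧ RemovesBar r' r := by
    intro a ha r hr
    rw [hshape (a + 1) (by omega)] at hr
    rw [hshape a (by omega)]
    refine hr.exists_removesBar (T.mono ⟨a, ha⟩) ?_ (T.step ⟨a, ha⟩)
    have := T.size ⟨a, ha⟩
    change (skewShifted (T.shape ⟨a + 1, _⟩) (T.shape ⟨a, _⟩)).card = _ at this
    rw [this]
    exact hodd _ (List.get_mem _ _)
  obtain ⟨R, hRk, hR, hRb⟩ := exists_chain_of_arrangements k shape hstep lam.part
    (hlast ▸ lam.isArrangement)
  -- Truncating the index at `k` extends the chain by the constant `lam.part`, as the conditions on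
  -- a filling involve every a.
  have hmin : ∀ a ≤ k, min a k = a := fun a ha => min_eq_left ha
  obtain ⟨U, hU⟩ := exists_skewBarTableau_of_chain (lam := lam) (mu := mu) k
    (fun a => R (min a k)) (fun a ha => by rw [min_eq_right ha, hRk])
    (fun a ha => by
      rw [hmin a ha.le, hmin (a + 1) ha]
      exact hRb a ha)
    (fun a => (hR _ (min_le_right a k)).eq_zero)
    (by
      rw [hmin 0 (Nat.zero_le k), ← hfirst]
      exact hR 0 (Nat.zero_le k))
  exact (Nat.sInf_le (Set.mem_range_self U)).trans hU

/-- The coefficient of `p_π` in `Q_{λ/μ}`. -/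
noncomputable def skewQCoeff (lam mu : StrictPartition) {n : ℕ} (pi : n.Partition) : ℚ :=
  ∑ᶠ T : StripTableau lam mu (pi.parts.sort (· ≥ ·)),
    (2 : ℚ) ^ pi.parts.card * T.weight / (zee pi : ℚ)

/-- The power sum expansion of `Q_{λ/μ}`. -/
noncomputable def skewQExpansion (lam mu : StrictPartition) : (Σ n : ℕ, n.Partition) →₀ ℚ :=
  ∑ pi ∈ Nat.Partition.odds (skewShifted lam mu).card,
    Finsupp.single ⟨_, pi⟩ (skewQCoeff lam mu pi)

theorem isPowerSumExpansion_iff (f : MvPowerSeries ℕ ℚ) (c : (Σ n : ℕ, n.Partition) →₀ ℚ) :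
    IsPowerSumExpansion f c ↔ f = Finsupp.linearCombination ℚ
      (fun pi : Σ n : ℕ, n.Partition => powerSumPartition pi.2) c := Iff.rfl

theorem isPowerSumExpansion_skewQ (lam mu : StrictPartition) :
    IsPowerSumExpansion (skewQ lam mu) (skewQExpansion lam mu) := by
  rw [isPowerSumExpansion_iff, skewQExpansion, map_sum, skewQ]
  refine Finset.sum_congr rfl fun pi _ => ?_
  rw [Finsupp.linearCombination_single, skewQCoeff, finsum_smul]

/-- The coefficient is a sum over strip tableaux of type π, so it can be nonzero only if one exists.
Cancellation among the weights does no harm. -/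
theorem srank_le_of_skewQExpansion_ne_zero {lam mu : StrictPartition}
    (x : Σ n : ℕ, n.Partition) (h : skewQExpansion lam mu x ≠ 0) :
    srank lam mu ≤ x.2.parts.card := by
  classical
  rw [skewQExpansion, Finsupp.finsetSum_apply] at h
  obtain ⟨pi, hpi, hne⟩ := Finset.exists_ne_zero_of_sum_ne_zero h
  rw [Finsupp.single_apply] at hne
  split_ifs at hne with hx
  · subst hx
    have hT : Nonempty (StripTableau lam mu (pi.parts.sort (· ≥ ·))) := by
      by_contra hempty
      rw [not_nonempty_iff] at hempty
      exact hne (finsum_of_isEmpty _)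
    obtain ⟨T⟩ := hT
    have hodd : ∀ y ∈ pi.parts.sort (· ≥ ·), Odd y := by
      intro y hy
      rw [Multiset.mem_sort] at hy
      exact Nat.not_even_iff_odd.1 ((Finset.mem_filter.1 hpi).2 y hy)
    simpa using T.srank_le hodd
  · exact absurd rfl hne

theorem mainTheorem4 (lam mu : StrictPartition) (hmu : mu ≤ lam) :
    (∃! c : (Σ n : ℕ, n.Partition) →₀ ℚ, IsPowerSumExpansion (skewQ lam mu) c) ∧
      ∀ c : (Σ n : ℕ, n.Partition) →₀ ℚ, IsPowerSumExpansion (skewQ lam mu) c →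
        ∀ (n : ℕ) (pi : n.Partition), c ⟨n, pi⟩ ≠ 0 → srank lam mu ≤ pi.parts.card := by
  have huniq : ∀ c : (Σ n : ℕ, n.Partition) →₀ ℚ, IsPowerSumExpansion (skewQ lam mu) c →
      c = skewQExpansion lam mu := by
    intro c hc
    have h := isPowerSumExpansion_skewQ lam mu
    rw [isPowerSumExpansion_iff] at hc h
    exact linearIndependent_powerSumPartition (hc.symm.trans h)
  refine ⟨⟨_, isPowerSumExpansion_skewQ lam mu, huniq⟩, fun c hc n pi hne => ?_⟩
  rw [huniq c hc] at hne
  exact srank_le_of_skewQExpansion_ne_zero ⟨n, pi⟩ hne
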